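/- **Setting.** Let $\mathcal S$ be a finite set of vertices with nonnegative weights $w$ and a cost $c(u,v)$, and let $m\ge 1$ robots with identifiers $1,\dots,m$ stand on vertices $Q=(q_1,\dots,q_m)\in\mathcal S^m$ (positions may coincide). The coverage cost is $\mathcal D(Q)=\sum_{v\in\mathcal S}\min_{i} w(v)c(v,q_i)$, and $Q^*$ denotes a configuration minimizing $\mathcal D$ over $\mathcal S^m$. Let $W_i$ be the set of vertices whose closest robot is $i$, ties going to the smaller identifier. The vertices, the cost and the neighbour sets $\mathcal N(i)\ni i$ arise in one of two ways. (a) *Graph.* $\mathcal S$ is the vertex set of a finite connected graph with nonnegative edge costs, and $c$ is the shortest-path cost (so $c$ agrees with the edge costs if these are metric). Put a dummy vertex of weight $0$ in the middle of every edge, let $\overline W_i\supseteq W_i$ be the cell of robot $i$ in the resulting graph (same tie rule), and let $r_i=\max_{p\in\overline W_i}c(p,q_i)$ (with $r_i=0$ if $\overline W_i=\emptyset$). Then $j\in\mathcal N(i)$ iff $c(q_i,q_j)\le 4\max\{r_i,r_j\}$. (b) *Sampled environment.* $\mathcal S$ is a finite subset of a compact space $\mathcal X$ in which $d(p,q)$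 is the length of a shortest path from $p$ to $q$, and $c(u,v)=f(d(u,v))$ with $f:\mathbb R_{+}\to\mathbb R_{+}$ strictly increasing and subadditive. Let $V_i=\{p\in\mathcal X: d(p,q_i)\le d(p,q_j)\ \forall j\}$ and $r_i=\max_{p\in V_i}d(p,q_i)$. Then $j\in\mathcal N(i)$ iff $d(q_i,q_j)\le 4\max\{r_i,r_j\}$. **Algorithm** with parameter $\varepsilon_0>0$. In a configuration $Q$ a robot $i$ with $\sum_{u\in W_i}c(u,q_i)>0$ looks for a local move as follows. *Type 1.* For $v\in W_i$ let $\delta_v$ be the change of the cost of the cells $W_j$, $j\in\mathcal N(i)$, computed with the robots of $\mathcal N(i)$ only, if $i$ moves to $v$. If $\min_{v\in W_i}\delta_v\le-\varepsilon_0$, robot $i$ moves to a minimizer. *Type 2.* Otherwise, with $R_j(v)=\{u\in W_j: c(u,v)<c(u,q_j)\}$, robot $i$ computes $\rho_v=\sum_{j\in\mathcal N(i)}\sum_{u\in R_j(v)}w(u)[c(u,v)-c(u,q_j)]$ for $v\in W_i$ and sends these values with counter $1$ to its neighbours. A robot $k$ that first receives the message, with counter $n$, from a robot called its parent computes $L_v=\sum_{u\in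 W_k\setminus R_k(v)}w(u)\bigl[\min\{c(u,v),\min_{j\in\mathcal N(k)\setminus\{k\}}c(u,q_j)\}-c(u,q_k)\bigr]$ if $n=1$, and $L_v=\sum_{u\in W_k}w(u)\bigl[\min_{j\in\mathcal N(k)\setminus\{k\}}c(u,q_j)-c(u,q_k)\bigr]$ if $n>1$. If $\rho_v+L_v\le-\varepsilon_0$ for some $v\in W_i$, robot $k$ accepts; otherwise it forwards the message with counter $n+1$ to its neighbours. If some robot accepts, the pair $(k,v)$ with the least value $\rho_v+L_v$ over the accepting robots $k$ and $v\in W_i$ is carried out: $i$ moves to $v$, and each robot on the chain of parents from $k$ to $i$, other than $i$, moves to its parent's old position. At the start all robots are active. In any order, active robots take turns: an active robot that has a local move makes it, after which all robots are active; an active robot that has no local move becomes inactive. The algorithm terminates when all robots are inactive. **Theorem.** In both settings (a) and (b), when the algorithm terminates, from any initial configuration, its final configuration $Q$ is within a factor $5+o(\varepsilon_0)$ of the optimum. Precisely: 1. for every $\varepsilon_0>0$, $\mathcal D(Q)\le 5\,\mathcal D(Q^*)+m\,\varepsilon_0$; 2. for every fixed instance $(\mathcal S,c,w,\mathcal N,m)$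 there is a function $g$ with $g(\varepsilon_0)=o(\varepsilon_0)$ as $\varepsilon_0\to0^+$ such that, for all sufficiently small $\varepsilon_0>0$, every final configuration $Q$ satisfies $\mathcal D(Q)\le(5+g(\varepsilon_0))\,\mathcal D(Q^*)$. -/

import Mathlib

open Filter Topology Asymptotics

noncomputable section

namespace Coverage

/-! ### Configurations, cells and the coverage cost

`m` robots, named by their unique identifiers in `Fin m`, stand on the vertices of a finite set `V`.
A configuration is a map `Q : Fin m → V`; `c u v` is the sensing cost between vertices and `w` the
weight of the vertices. -/

/-- The coverage cost `∑ v, min_{q ∈ Q} w v * c v q`. -/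
def cost {V : Type*} [Fintype V] {m : ℕ} (c : V → V → ℝ) (w : V → ℝ) (Q : Fin m → V) : ℝ :=
  ∑ v, ⨅ j, w v * c v (Q j)

/-- `Q` has the least coverage cost among all configurations of `m` robots. -/
def IsOptimal {V : Type*} [Fintype V] {m : ℕ} (c : V → V → ℝ) (w : V → ℝ) (Q : Fin m → V) : Prop :=
  ∀ Q' : Fin m → V, cost c w Q ≤ cost c w Q'

/-- The cell of robot `i`: the points that are closest to robot `i`, a tie being won by the robot
with the smaller identifier. Here `κ p j` is the distance from the point `p` to robot `j`. -/
def cell {P : Type*} {m : ℕ} (κ : P → Fin m → ℝ) (i : Fin m) : Set P :=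
  {p | ∀ j, κ p i ≤ κ p j ∧ (j < i → κ p i < κ p j)}

/-- The partition `W_i(Q)` of the vertices. -/
def W {V : Type*} {m : ℕ} (c : V → V → ℝ) (Q : Fin m → V) (i : Fin m) : Set V :=
  cell (fun u j => c u (Q j)) i

/-! ### The distributed algorithm

`N Q i j` says that robot `j` is a neighbour of robot `i` in the configuration `Q` (every robot is a
neighbour of itself). -/

section Algorithm

variable {V : Type*} [Fintype V] {m : ℕ} (c : V → V → ℝ) (w : V → ℝ)
  (N : (Fin m → V) → Fin m → Fin m → Prop) (ε₀ : ℝ)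

open scoped Classical in
/-- `δ_v`: the change of the cost of the cells of the neighbours of robot `i` (its own cell
included) if robot `i` moves to `v`, computed from the positions of these neighbours. -/
def delta (Q : Fin m → V) (i : Fin m) (v : V) : ℝ :=
  ∑ j with N Q i j, ∑ u with u ∈ W c Q j,
    w u * ((⨅ k : {k // N Q i k}, c u (Function.update Q i v k)) - c u (Q j))

open scoped Classical in
/-- `ρ_v`: the change of the cost of these cells if robot `i` moves to `v` and a new robot appears
at the old position of robot `i`. The inner sum is over `R_j(v)`. -/
def rho (Q : Fin m → V) (i : Fin m) (v : V) : ℝ :=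
  ∑ j with N Q i j, ∑ u with u ∈ W c Q j ∧ c u v < c u (Q j), w u * (c u v - c u (Q j))

/-- The sensing cost of `u` by the best neighbour of robot `k` other than robot `k` itself. -/
def otherCost (Q : Fin m → V) (k : Fin m) (u : V) : ℝ :=
  ⨅ j : {j // N Q k j ∧ j ≠ k}, c u (Q j)

open scoped Classical in
/-- `ℓ_v`: the change of the cost of `W_k \ R_k(v)` if robot `k` leaves its position, which is taken
up by the other neighbours of `k` and by the robot that has moved to `v`. -/
def lossNear (Q : Fin m → V) (k : Fin m) (v : V) : ℝ :=
  ∑ u with u ∈ W c Q k ∧ ¬ c u v < c u (Q k),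
    w u * (min (otherCost c N Q k u) (c u v) - c u (Q k))

open scoped Classical in
/-- `ℓ`: the change of the cost of `W_k` if robot `k` leaves its position, which is taken up by the
other neighbours of `k`. -/
def lossFar (Q : Fin m → V) (k : Fin m) : ℝ :=
  ∑ u with u ∈ W c Q k, w u * (otherCost c N Q k u - c u (Q k))

/-- The change that robot `k` computes for the proposal "robot `i` moves to `v`, robot `k` leaves its
position" when it receives the message of robot `i` with counter `n`. -/
def offer (Q : Fin m → V) (i : Fin m) (n : ℕ) (k : Fin m) (v : V) : ℝ :=
  rho c w N Q i v + if n = 1 then lossNear c w N Q k v else lossFar c w N Q k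

/-- Robot `k` accepts the message of robot `i` that it receives with counter `n`. -/
def Accepts (Q : Fin m → V) (i : Fin m) (n : ℕ) (k : Fin m) : Prop :=
  ∃ v ∈ W c Q i, offer c w N Q i n k v ≤ -ε₀

/-- How the message of robot `i` spreads. The second component is the set of robots that receive it
for the first time with counter `n` (for `n = 0`, the sender `i`), the first component the set of
robots that have it by then. A robot that accepts does not pass the message on; one that does not
accept sends it, with the counter increased by one, to its neighbours. -/
def spread (Q : Fin m → V) (i : Fin m) : ℕ → Set (Fin m) × Set (Fin m)
  | 0 => ({i}, {i})
  | n + 1 =>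
    let new : Set (Fin m) := {k | k ∉ (spread Q i n).1 ∧
      ∃ j ∈ (spread Q i n).2, (n = 0 ∨ ¬ Accepts c w N ε₀ Q i n j) ∧ N Q j k}
    ((spread Q i n).1 ∪ new, new)

/-- `k` receives the message of robot `i` for the first time with counter `n`. -/
def Receives (Q : Fin m → V) (i : Fin m) (n : ℕ) (k : Fin m) : Prop :=
  k ∈ (spread c w N ε₀ Q i n).2

/-- `p 0 = i, p 1, …, p n` is a chain of robots in which each `p t` is the parent of `p (t + 1)`:
the latter has first received the message of robot `i` from the former. -/
def IsParentChain (Q : Fin m → V) (i : Fin m) (n : ℕ) (p : ℕ → Fin m) : Prop :=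
  p 0 = i ∧ ∀ t < n, Receives c w N ε₀ Q i (t + 1) (p (t + 1)) ∧ N Q (p t) (p (t + 1)) ∧
    (t = 0 ∨ ¬ Accepts c w N ε₀ Q i t (p t))

/-- A local move of type 1: robot `i` moves inside its cell, to a vertex with the least `δ_v`. -/
def MoveOne (i : Fin m) (Q Q' : Fin m → V) : Prop :=
  ∃ v ∈ W c Q i, delta c w N Q i v ≤ -ε₀ ∧
    (∀ v' ∈ W c Q i, delta c w N Q i v ≤ delta c w N Q i v') ∧
    Q' = Function.update Q i v

/-- A local move of type 2, made when there is none of type 1: among all acceptances robot `i`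
selects the one with the largest improvement, coming from the robot `p n`; it moves to the vertex
`v`, and each robot of the chain from `i` to `p n` moves to the position of its parent. -/
def MoveTwo (i : Fin m) (Q Q' : Fin m → V) : Prop :=
  (∀ v ∈ W c Q i, -ε₀ < delta c w N Q i v) ∧
  ∃ (n : ℕ) (p : ℕ → Fin m), 1 ≤ n ∧ IsParentChain c w N ε₀ Q i n p ∧
    ∃ v ∈ W c Q i, offer c w N Q i n (p n) v ≤ -ε₀ ∧
      (∀ n' k' v', 1 ≤ n' → Receives c w N ε₀ Q i n' k' → v' ∈ W c Q i →
        offer c w N Q i n (p n) v ≤ offer c w N Q i n' k' v') ∧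
      Q' i = v ∧ (∀ t < n, Q' (p (t + 1)) = Q (p t)) ∧ ∀ k, (∀ t ≤ n, k ≠ p t) → Q' k = Q k

open scoped Classical in
/-- One iteration of the local move procedure of robot `i`, which is entered only if the
(unweighted) sensing cost of the cell of `i` is positive. -/
def LocalMove (i : Fin m) (Q Q' : Fin m → V) : Prop :=
  0 < ∑ u with u ∈ W c Q i, c u (Q i) ∧
    (MoveOne c w N ε₀ i Q Q' ∨ MoveTwo c w N ε₀ i Q Q')

/-- A step of the algorithm, on states that consist of a configuration and the set of active robots:
an active robot makes a local move, whereupon all robots have to check the new configuration and are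
active; or an active robot that cannot make a local move becomes inactive. The order in which the
active robots get their turns is arbitrary. -/
inductive Step : (Fin m → V) × Set (Fin m) → (Fin m → V) × Set (Fin m) → Prop
  | move {Q Q' : Fin m → V} {A : Set (Fin m)} {i : Fin m} (hi : i ∈ A)
      (h : LocalMove c w N ε₀ i Q Q') : Step (Q, A) (Q', Set.univ)
  | deactivate {Q : Fin m → V} {A : Set (Fin m)} {i : Fin m} (hi : i ∈ A)
      (h : ¬ ∃ Q', LocalMove c w N ε₀ i Q Q') : Step (Q, A) (Q, A \ {i})

/-- Started at `Q₀` with all robots active, the algorithm can terminate with the configuration `Q`: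
all robots are inactive. -/
def TerminatesAt (Q₀ Q : Fin m → V) : Prop :=
  Relation.ReflTransGen (Step c w N ε₀) (Q₀, Set.univ) (Q, ∅)

/-- The algorithm is a `5 + o(ε₀)` approximation. First, quantitatively and for every `ε₀ > 0`, the
final cost is at most `5 · OPT + m · ε₀`. Second, as `ε₀ → 0` on the given instance, the final cost is
at most `(5 + o(ε₀)) · OPT`. -/
def ApproxGuarantee : Prop :=
  (∀ ε₀ : ℝ, 0 < ε₀ → ∀ Q₀ Q Qopt : Fin m → V, TerminatesAt c w N ε₀ Q₀ Q → IsOptimal c w Qopt →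
    cost c w Q ≤ 5 * cost c w Qopt + m * ε₀) ∧
  ∃ g : ℝ → ℝ, g =o[𝓝[>] 0] (fun ε => ε) ∧
    ∀ᶠ ε₀ in 𝓝[>] (0 : ℝ), ∀ Q₀ Q Qopt : Fin m → V,
      TerminatesAt c w N ε₀ Q₀ Q → IsOptimal c w Qopt →
        cost c w Q ≤ (5 + g ε₀) * cost c w Qopt

end Algorithm

/-! ### Neighbours in a graph -/

section Graph

/-- Length of a shortest walk from `u` to `v`, if an edge from `x` to `y` has length `len x y`. -/
def graphDist {P : Type*} (G : SimpleGraph P) (len : P → P → ℝ) (u v : P) : ℝ :=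
  ⨅ p : G.Walk u v, (p.darts.map fun d => len d.fst d.snd).sum

variable {V : Type*} (G : SimpleGraph V) (len : Sym2 V → ℝ)

/-- The shortest path cost between the vertices of a graph with edge costs `len`. (If `len` is
metric, that is, no edge is longer than a walk between its ends, this agrees with `len` on the
edges.) -/
def graphCost (u v : V) : ℝ := graphDist G (fun x y => len s(x, y)) u v

/-- The graph in which a dummy vertex is placed in the middle of every edge. -/
def subdivision : SimpleGraph (V ⊕ G.edgeSet) where
  Adj
    | .inl u, .inr e => u ∈ e.1
    | .inr e, .inl u => u ∈ e.1
    | _, _ => False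
  symm := ⟨by rintro (u | e) (v | e') h <;> exact h⟩
  loopless := ⟨by rintro (u | e) h <;> exact h⟩

/-- Every edge of the subdivision is half of an edge of the graph. -/
def subdivisionLen : V ⊕ G.edgeSet → V ⊕ G.edgeSet → ℝ
  | .inl _, .inr e => len e.1 / 2
  | .inr e, .inl _ => len e.1 / 2
  | _, _ => 0

/-- Distance from a vertex of the subdivision to robot `j`. -/
def robotDist {m : ℕ} (Q : Fin m → V) (p : V ⊕ G.edgeSet) (j : Fin m) : ℝ :=
  graphDist (subdivision G) (subdivisionLen G len) p (.inl (Q j))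

/-- The largest distance to robot `i` in its cell of the subdivision (`0` if the cell is empty). -/
def cellRadius {m : ℕ} (Q : Fin m → V) (i : Fin m) : ℝ :=
  sSup ((fun p => robotDist G len Q p i) '' cell (robotDist G len Q) i)

/-- Neighbour robots in a graph. -/
def GraphNeighbour {m : ℕ} (Q : Fin m → V) (i j : Fin m) : Prop :=
  graphCost G len (Q i) (Q j) ≤ 4 * max (cellRadius G len Q i) (cellRadius G len Q j)

end Graph

/-! ### Neighbours in a continuous environment -/

section Environment

variable {X : Type*} [MetricSpace X]

/-- The distance of `X` is the length of a shortest path: any two points are joined by a path,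
parametrized by arc length, whose length is their distance. -/
def IsGeodesic (X : Type*) [MetricSpace X] : Prop :=
  ∀ p q : X, ∃ γ : ℝ → X, γ 0 = p ∧ γ (dist p q) = q ∧
    ∀ s ∈ Set.Icc 0 (dist p q), ∀ t ∈ Set.Icc 0 (dist p q), dist (γ s) (γ t) = |s - t|

/-- The Voronoi cell of robot `i` in the environment. -/
def voronoi {S : Finset X} {m : ℕ} (Q : Fin m → S) (i : Fin m) : Set X :=
  {p | ∀ j, dist p (Q i) ≤ dist p (Q j)}

/-- The largest distance to robot `i` in its Voronoi cell. -/
def voronoiRadius {S : Finset X} {m : ℕ} (Q : Fin m → S) (i : Fin m) : ℝ :=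
  sSup ((fun p => dist p (Q i : X)) '' voronoi Q i)

/-- Neighbour robots in a continuous environment. -/
def EnvNeighbour {S : Finset X} {m : ℕ} (Q : Fin m → S) (i j : Fin m) : Prop :=
  dist (Q i : X) (Q j) ≤ 4 * max (voronoiRadius Q i) (voronoiRadius Q j)

/-- The cost between sampled locations, for the sensing function `f`. -/
def envCost (S : Finset X) (f : ℝ → ℝ) (u v : S) : ℝ := f (dist (u : X) v)

end Environment

end Coverage

end

/-!
The argument is the single-swap analysis of local search for `k`-median. Every location `O l` of an
optimal configuration is paired with a robot `s l` of the final configuration `Q` whose cell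
contains no location of `O` other than `O l`, in such a way that no robot is used more than twice.
If `s l` is replaced by a robot at `O l`, the vertices served by `l` in `O` switch to `O l`, and
each other vertex `u` left by `s l` switches to the robot closest to its location in `O`, which by
the triangle inequality costs at most `2 * nearestCost c O u` more. Summed over `l`, the swaps
change the cost by at most `5 * cost c w O - cost c w Q`.

The swap at `l` is a move that the robot `i` whose cell contains `O l` has considered in vain, so it
changes the cost by at least `-ε₀`: by itself if `s l = i`, and otherwise with the help of `s l`,
which the message of `i` reaches because the neighbour relation is connected and nobody accepts. (If
`i` has not looked for a move, its cell has cost zero, and a robot at `O l` gains nothing.) Together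
this is the bound with error `m * ε₀`. Since there are only finitely many configurations, for small
`ε₀` the error is below every positive gap `cost c w Q - 5 * cost c w O`, so that `g = 0` works.
-/

namespace Coverage

section Pairing

variable {α β : Type*} [Fintype α] [Fintype β]

theorem exists_card_fiber_le [DecidableEq β] {n : ℕ}
    (h : Fintype.card α ≤ n * Fintype.card β) :
    ∃ f : α → β, ∀ b, Finset.card {a | f a = b} ≤ n := by
  obtain ⟨e⟩ : Nonempty (α ↪ β × Fin n) :=
    Function.Embedding.nonempty_of_card_le (by simpa [mul_comm] using h)
  refine ⟨fun a => (e a).1, fun b => ?_⟩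
  have hinj : Set.InjOn (fun a => (e a).2) ({a | (e a).1 = b} : Finset α) := fun a ha a' ha' h =>
    e.injective (Prod.ext (by simp_all) h)
  simpa using Finset.card_le_card_of_injOn (t := Finset.univ) _ (fun _ _ => Finset.mem_univ _) hinj

theorem card_collisions_le [DecidableEq α] [DecidableEq β]
    (h : Fintype.card α ≤ Fintype.card β) (f : α → β) :
    Fintype.card {a // ∃ a', f a' = f a ∧ a' ≠ a} ≤ 2 * Fintype.card {b // b ∉ Set.range f} := by
  let D : Finset α := {a | ∃ a', f a' = f a ∧ a' ≠ a}
  have himage : 2 * (D.image f).card ≤ D.card := by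
    refine Finset.mul_card_image_le_card D 2 fun b hb => ?_
    obtain ⟨a, ha, rfl⟩ := Finset.mem_image.1 hb
    obtain ⟨a', hfa, hne⟩ := (Finset.mem_filter.1 ha).2
    refine Finset.one_lt_card.2 ⟨a, by simpa using ha, a', ?_, hne.symm⟩
    exact Finset.mem_filter.2 ⟨Finset.mem_filter.2 ⟨Finset.mem_univ _, a, hfa.symm, hne.symm⟩, hfa⟩
  have hrange : (Finset.univ.image f).card ≤ (D.image f).card + Dᶜ.card := by
    rw [← Finset.union_compl D, Finset.image_union]
    exact (Finset.card_union_le _ _).trans (by gcongr; exact Finset.card_image_le)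
  have hD := Finset.card_add_card_compl D
  have hf := Finset.card_add_card_compl (Finset.univ.image f)
  have hmissed : Fintype.card {b // b ∉ Set.range f} = (Finset.univ.image f)ᶜ.card :=
    Fintype.card_of_subtype _ (by simp)
  rw [Fintype.card_of_subtype D (by simp [D]), hmissed]
  omega

theorem exists_swap_pairing [DecidableEq β] (h : Fintype.card α ≤ Fintype.card β) (f : α → β) :
    ∃ s : α → β, (∀ a a', f a' = s a → a' = a) ∧ ∀ b, Finset.card {a | s a = b} ≤ 2 := by
  classical
  obtain ⟨g, hg⟩ := exists_card_fiber_le (card_collisions_le h f)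
  let s : α → β := fun a => if ha : ∃ a', f a' = f a ∧ a' ≠ a then g ⟨a, ha⟩ else f a
  have hs_pos : ∀ {a} (ha : ∃ a', f a' = f a ∧ a' ≠ a), s a = g ⟨a, ha⟩ := fun ha => dif_pos ha
  have hs_neg : ∀ {a}, (¬ ∃ a', f a' = f a ∧ a' ≠ a) → s a = f a := fun ha => dif_neg ha
  have hs_mem : ∀ {a}, s a ∈ Set.range f → f a = s a ∧ ∀ a', f a' = f a → a' = a := by
    intro a ha
    by_cases hcol : ∃ a', f a' = f a ∧ a' ≠ a
    · exact ((g ⟨a, hcol⟩).2 (hs_pos hcol ▸ ha)).elim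
    · refine ⟨(hs_neg hcol).symm, ?_⟩
      push Not at hcol
      exact hcol
  refine ⟨s, fun a a' haa' => ?_, fun b => ?_⟩
  · obtain ⟨hsa, huniq⟩ := hs_mem ⟨a', haa'⟩
    exact huniq a' (haa'.trans hsa.symm)
  · by_cases hb : b ∈ Set.range f
    · refine (Finset.card_le_one.2 fun a ha a' ha' => ?_).trans one_le_two
      obtain rfl : s a = b := by simpa using ha
      have hsa' : s a' = s a := by simpa using ha'
      obtain ⟨hfa, -⟩ := hs_mem hb
      obtain ⟨hfa', huniq⟩ := hs_mem (hsa' ▸ hb)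
      exact huniq a (by rw [hfa, hfa', hsa'])
    · refine le_trans (Finset.card_le_card fun a ha => ?_)
        ((Finset.card_map (Function.Embedding.subtype _)).trans_le (hg ⟨b, hb⟩))
      obtain rfl : s a = b := by simpa using ha
      have hcol : ∃ a', f a' = f a ∧ a' ≠ a := by
        by_contra hcol
        exact hb ⟨a, (hs_neg hcol).symm⟩
      simp only [Finset.mem_map, Finset.mem_filter, Finset.mem_univ, true_and]
      exact ⟨⟨a, hcol⟩, Subtype.ext (hs_pos hcol).symm, rfl⟩

end Pairing

section Cells

variable {P : Type*} {m : ℕ} {κ : P → Fin m → ℝ} {T : Set (Fin m)} {p : P} {i j k : Fin m}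

/-- Robot `i` is the closest robot of `T` to the point `p`, under the tie rule of `cell`. It is used
for `T` the complement of one robot, whose points have to be taken over by the others. -/
def IsClosestIn (κ : P → Fin m → ℝ) (T : Set (Fin m)) (p : P) (i : Fin m) : Prop :=
  i ∈ T ∧ ∀ j ∈ T, κ p i ≤ κ p j ∧ (j < i → κ p i < κ p j)

theorem exists_isClosestIn (κ : P → Fin m → ℝ) (hT : T.Nonempty) (p : P) :
    ∃ i, IsClosestIn κ T p i := by
  obtain ⟨i, hi, hmin⟩ := T.exists_min_image (fun i => toLex (κ p i, i)) T.toFinite hT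
  refine ⟨i, hi, fun j hj => ?_⟩
  rcases Prod.Lex.toLex_le_toLex.1 (hmin j hj) with hlt | ⟨heq, hij⟩
  · exact ⟨hlt.le, fun _ => hlt⟩
  · exact ⟨heq.le, fun hji => (hij.not_gt hji).elim⟩

theorem IsClosestIn.unique (hi : IsClosestIn κ T p i) (hj : IsClosestIn κ T p j) : i = j := by
  rcases lt_trichotomy i j with h | h | h
  · exact ((hi.2 j hj.1).1.not_gt ((hj.2 i hi.1).2 h)).elim
  · exact h
  · exact ((hj.2 i hi.1).1.not_gt ((hi.2 j hj.1).2 h)).elim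

theorem mem_cell_iff_isClosestIn_univ : p ∈ cell κ i ↔ IsClosestIn κ Set.univ p i := by
  simp [cell, IsClosestIn]

/-- The robot whose cell contains the point `p`. -/
noncomputable def owner [Nonempty (Fin m)] (κ : P → Fin m → ℝ) (p : P) : Fin m :=
  (exists_isClosestIn κ Set.univ_nonempty p).choose

theorem mem_cell_iff_owner_eq [Nonempty (Fin m)] : p ∈ cell κ i ↔ owner κ p = i := by
  have howner := (exists_isClosestIn κ Set.univ_nonempty p).choose_spec
  rw [mem_cell_iff_isClosestIn_univ]
  exact ⟨howner.unique, fun h => h ▸ howner⟩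

theorem mem_cell_owner [Nonempty (Fin m)] (κ : P → Fin m → ℝ) (p : P) : p ∈ cell κ (owner κ p) :=
  mem_cell_iff_owner_eq.2 rfl

theorem IsClosestIn.mem_cell (hj : IsClosestIn κ {k}ᶜ p j) (hk : p ∉ cell κ k) :
    p ∈ cell κ j := by
  have : Nonempty (Fin m) := ⟨k⟩
  have hne : owner κ p ≠ k := mt mem_cell_iff_owner_eq.2 hk
  have howner : IsClosestIn κ {k}ᶜ p (owner κ p) := ⟨hne, fun l _ => mem_cell_owner κ p l⟩
  exact mem_cell_iff_owner_eq.2 (howner.unique hj)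

theorem IsClosestIn.of_between {D : P → P → ℝ} (tri : ∀ a b d, D a d ≤ D a b + D b d)
    {x : Fin m → P} {a b : P} (hj : IsClosestIn (fun p i => D p (x i)) T a j)
    (hb : D a b + D b (x j) ≤ D a (x j)) : IsClosestIn (fun p i => D p (x i)) T b j := by
  refine ⟨hj.1, fun l hl => ?_⟩
  have htri := tri a b (x l)
  obtain ⟨hle, hlt⟩ := hj.2 l hl
  exact ⟨by linarith, fun hlj => by linarith [hlt hlj]⟩

end Cells

section Algorithm

variable {V : Type*} [Fintype V] {m : ℕ} {c : V → V → ℝ} {w : V → ℝ}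
  {N : (Fin m → V) → Fin m → Fin m → Prop} {ε₀ : ℝ} {Q : Fin m → V} {i : Fin m}

theorem not_localMove_of_reachable {Q₀ : Fin m → V} {x : (Fin m → V) × Set (Fin m)}
    (hx : Relation.ReflTransGen (Step c w N ε₀) (Q₀, Set.univ) x) (hi : i ∉ x.2) :
    ¬ ∃ Q', LocalMove c w N ε₀ i x.1 Q' := by
  induction hx generalizing i with
  | refl => exact (hi trivial).elim
  | tail _ hstep ih =>
    cases hstep with
    | move => exact (hi trivial).elim
    | @deactivate _ _ k _ hk =>
      by_cases hik : i = k
      · exact hik ▸ hk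
      · exact ih fun hiA => hi ⟨hiA, hik⟩

theorem TerminatesAt.not_localMove {Q₀ : Fin m → V} (h : TerminatesAt c w N ε₀ Q₀ Q)
    (i : Fin m) : ¬ ∃ Q', LocalMove c w N ε₀ i Q Q' :=
  not_localMove_of_reachable h (Set.notMem_empty i)

theorem mem_spread_iff {n : ℕ} {k : Fin m} :
    k ∈ (spread c w N ε₀ Q i n).1 ↔ ∃ t ≤ n, Receives c w N ε₀ Q i t k := by
  induction n with
  | zero => simp [Receives, spread]
  | succ n ih =>
    simp only [Nat.le_succ_iff, or_and_right, exists_or, exists_eq_left, ← ih]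
    rfl

theorem Receives.unique {s t : ℕ} {k : Fin m} (hs : Receives c w N ε₀ Q i s k)
    (ht : Receives c w N ε₀ Q i t k) : s = t := by
  have not_lt : ∀ {a b : ℕ}, Receives c w N ε₀ Q i a k → Receives c w N ε₀ Q i b k → ¬ a < b := by
    intro a b ha hb hab
    obtain ⟨b, rfl⟩ := Nat.exists_eq_succ_of_ne_zero hab.ne_bot
    exact hb.1 (mem_spread_iff.2 ⟨a, Nat.lt_succ_iff.1 hab, ha⟩)
  exact le_antisymm (le_of_not_gt (not_lt ht hs)) (le_of_not_gt (not_lt hs ht))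

theorem IsParentChain.receives {n : ℕ} {p : ℕ → Fin m} (h : IsParentChain c w N ε₀ Q i n p)
    {t : ℕ} (ht : t ≤ n) : Receives c w N ε₀ Q i t (p t) := by
  cases t with
  | zero => exact h.1
  | succ t => exact (h.2 t ht).1

theorem IsParentChain.injOn {n : ℕ} {p : ℕ → Fin m} (h : IsParentChain c w N ε₀ Q i n p) :
    Set.InjOn p (Set.Iic n) :=
  fun _ hs _ ht hst => (h.receives hs).unique (hst ▸ h.receives ht)

theorem Receives.exists_isParentChain {n : ℕ} {k : Fin m} (h : Receives c w N ε₀ Q i n k) :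
    ∃ p, IsParentChain c w N ε₀ Q i n p ∧ p n = k := by
  induction n generalizing k with
  | zero => exact ⟨fun _ => k, ⟨h, fun t ht => (Nat.not_lt_zero t ht).elim⟩, rfl⟩
  | succ n ih =>
    obtain ⟨-, j, hj, hacc, hN⟩ := id h
    obtain ⟨p, ⟨hp0, hp⟩, rfl⟩ := ih hj
    refine ⟨fun t => if t ≤ n then p t else k, ⟨by simpa using hp0, fun t ht => ?_⟩, by simp⟩
    rcases Nat.lt_succ_iff_lt_or_eq.1 ht with hlt | rfl
    · simpa [hlt.le, Nat.succ_le_iff.2 hlt] using hp t hlt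
    · simpa using ⟨h, hN, hacc⟩

theorem exists_shift_along {α β : Type*} {n : ℕ} {p : ℕ → α} (hp : Set.InjOn p (Set.Iic n))
    (f : α → β) (b : β) : ∃ g : α → β, g (p 0) = b ∧ (∀ t < n, g (p (t + 1)) = f (p t)) ∧
      ∀ a, (∀ t ≤ n, a ≠ p t) → g a = f a := by
  let shifted : ℕ → β := fun | 0 => b | t + 1 => f (p t)
  let g : α → β := Function.extend ((Set.Iic n).domRestrict p) ((Set.Iic n).domRestrict shifted) f
  have hg : ∀ t ≤ n, g (p t) = shifted t := fun t ht =>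
    (Set.injOn_iff_injective.1 hp).extend_apply _ _ ⟨t, ht⟩
  refine ⟨g, hg 0 n.zero_le, fun t ht => hg (t + 1) ht, fun a ha => ?_⟩
  exact Function.extend_apply' _ _ _ fun ⟨t, ht⟩ => ha t t.2 ht.symm

open scoped Classical in
theorem neg_lt_delta (h : ¬ ∃ Q', LocalMove c w N ε₀ i Q Q')
    (hpos : 0 < ∑ u with u ∈ W c Q i, c u (Q i)) {v : V} (hv : v ∈ W c Q i) :
    -ε₀ < delta c w N Q i v := by
  by_contra! hle
  obtain ⟨v', hv', hmin⟩ :=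
    (W c Q i).exists_min_image (delta c w N Q i) (Set.toFinite _) ⟨v, hv⟩
  exact h ⟨_, hpos, Or.inl ⟨v', hv', (hmin v hv).trans hle, hmin, rfl⟩⟩

open scoped Classical in
theorem neg_lt_offer (h : ¬ ∃ Q', LocalMove c w N ε₀ i Q Q')
    (hpos : 0 < ∑ u with u ∈ W c Q i, c u (Q i)) {n : ℕ} {k : Fin m} {v : V} (hn : 1 ≤ n)
    (hk : Receives c w N ε₀ Q i n k) (hv : v ∈ W c Q i) : -ε₀ < offer c w N Q i n k v := by
  by_contra! hle
  let proposals : Set (ℕ × Fin m × V) :=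
    {x | 1 ≤ x.1 ∧ Receives c w N ε₀ Q i x.1 x.2.1 ∧ x.2.2 ∈ W c Q i}
  have hfin : proposals.Finite := by
    refine Set.Finite.of_injOn (f := Prod.snd) (Set.mapsTo_univ _ _) ?_ Set.finite_univ
    rintro ⟨a, x⟩ hx ⟨b, y⟩ hy rfl
    exact Prod.ext (hx.2.1.unique hy.2.1) rfl
  obtain ⟨⟨n', k', v'⟩, ⟨hn', hk', hv'⟩, hmin⟩ := proposals.exists_min_image
    (fun x => offer c w N Q i x.1 x.2.1 x.2.2) hfin ⟨(n, k, v), hn, hk, hv⟩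
  dsimp only at hn' hk' hv' hmin
  obtain ⟨p, hp, rfl⟩ := hk'.exists_isParentChain
  obtain ⟨Q', hstart, hshift, hrest⟩ := exists_shift_along hp.injOn Q v'
  exact h ⟨Q', hpos, Or.inr ⟨fun v hv => neg_lt_delta h hpos hv, n', p, hn', hp, v', hv',
    (hmin (n, k, v) ⟨hn, hk, hv⟩).trans hle,
    fun a b x ha hb hx => hmin (a, b, x) ⟨ha, hb, hx⟩, hp.1 ▸ hstart, hshift, hrest⟩⟩

open scoped Classical in
theorem exists_receives (h : ¬ ∃ Q', LocalMove c w N ε₀ i Q Q')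
    (hpos : 0 < ∑ u with u ∈ W c Q i, c u (Q i)) {k : Fin m}
    (hk : Relation.ReflTransGen (N Q) i k) : ∃ n, Receives c w N ε₀ Q i n k := by
  induction hk with
  | refl => exact ⟨0, rfl⟩
  | @tail j k _ hjk ih =>
    obtain ⟨n, hn⟩ := ih
    by_cases hmem : k ∈ (spread c w N ε₀ Q i n).1
    · obtain ⟨t, -, ht⟩ := mem_spread_iff.1 hmem
      exact ⟨t, ht⟩
    · refine ⟨n + 1, hmem, j, hn, ?_, hjk⟩
      rcases n.eq_zero_or_pos with rfl | hpos_n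
      · exact Or.inl rfl
      · exact Or.inr fun ⟨v, hv, hle⟩ => (neg_lt_offer h hpos hpos_n hn hv).not_ge hle

end Algorithm

section Analysis

variable {V : Type*} {m : ℕ} {c : V → V → ℝ} {Q O : Fin m → V} {i j k l s : Fin m} {u v : V}

/-- The properties of the cost that the analysis uses. It is symmetric and satisfies the triangle
inequality; it need not vanish on the diagonal, as `f ∘ dist` does not for `0 < f 0`. -/
structure IsMetricCost (c : V → V → ℝ) : Prop where
  symm : ∀ u v, c u v = c v u
  triangle : ∀ u v x, c u x ≤ c u v + c v x

theorem IsMetricCost.nonneg (hc : IsMetricCost c) (u v : V) : 0 ≤ c u v := by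
  have hself := hc.triangle u u u
  have hback := hc.triangle u v u
  rw [hc.symm v u] at hback
  linarith

/-- The properties of the neighbour relation `N` in the configuration `Q` that the analysis uses:
robot `i` has every robot `j` as a neighbour for which it can serve some vertex better from inside
its own cell, and a leaving robot is replaced optimally by its other neighbours. -/
structure IsNeighbourRelation (c : V → V → ℝ) (Q : Fin m → V) (N : Fin m → Fin m → Prop) :
    Prop where
  refl : ∀ i, N i i
  of_lt : ∀ {i j u v}, u ∈ W c Q j → v ∈ W c Q i → c u v < c u (Q j) → N i j
  exists_other : ∀ {k j u}, u ∈ W c Q k → j ≠ k → ∃ j', N k j' ∧ j' ≠ k ∧ c u (Q j') ≤ c u (Q j)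
  connected : ∀ i k, Relation.ReflTransGen N i k

/-- The sensing cost of `u` by the best robot. -/
noncomputable def nearestCost (c : V → V → ℝ) (Q : Fin m → V) (u : V) : ℝ := ⨅ j, c u (Q j)

theorem nearestCost_le (c : V → V → ℝ) (Q : Fin m → V) (u : V) (j : Fin m) :
    nearestCost c Q u ≤ c u (Q j) :=
  ciInf_le (Set.finite_range _).bddBelow j

theorem nearestCost_eq_of_mem_W (hu : u ∈ W c Q i) : nearestCost c Q u = c u (Q i) := by
  have : Nonempty (Fin m) := ⟨i⟩
  exact le_antisymm (nearestCost_le c Q u i) (le_ciInf fun j => (hu j).1)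

section Server

variable [Nonempty (Fin m)]

/-- The robot that serves the vertex `u`: the one whose cell contains `u`. -/
noncomputable def server (c : V → V → ℝ) (Q : Fin m → V) (u : V) : Fin m :=
  owner (fun u j => c u (Q j)) u

theorem mem_W_iff : u ∈ W c Q i ↔ server c Q u = i :=
  mem_cell_iff_owner_eq

theorem mem_W_server (c : V → V → ℝ) (Q : Fin m → V) (u : V) : u ∈ W c Q (server c Q u) :=
  mem_W_iff.2 rfl

theorem nearestCost_eq (c : V → V → ℝ) (Q : Fin m → V) (u : V) :
    nearestCost c Q u = c u (Q (server c Q u)) :=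
  nearestCost_eq_of_mem_W (mem_W_server c Q u)

theorem IsMetricCost.nearestCost_nonneg (hc : IsMetricCost c) (Q : Fin m → V) (u : V) :
    0 ≤ nearestCost c Q u :=
  le_ciInf fun _ => hc.nonneg _ _

theorem IsMetricCost.cost_le_of_mem_W (hc : IsMetricCost c) (hv : v ∈ W c Q i) (u : V) :
    c u (Q i) ≤ 2 * c u v + nearestCost c Q u := by
  rw [nearestCost_eq]
  calc c u (Q i) ≤ c u v + c v (Q i) := hc.triangle _ _ _
    _ ≤ c u v + c v (Q (server c Q u)) := by gcongr; exact (hv _).1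
    _ ≤ c u v + (c v u + c u (Q (server c Q u))) := by gcongr; exact hc.triangle _ _ _
    _ = 2 * c u v + c u (Q (server c Q u)) := by rw [hc.symm v u]; ring

theorem IsMetricCost.cost_reassign_le (hc : IsMetricCost c) (Q O : Fin m → V) (u : V) :
    c u (Q (server c Q (O (server c O u)))) ≤ 2 * nearestCost c O u + nearestCost c Q u := by
  rw [nearestCost_eq c O]
  exact hc.cost_le_of_mem_W (mem_W_server c Q _) u

/-- The change of the sensing cost of `u` that is charged to swapping robot `s` for a robot at
`O l`: a vertex served by `l` in `O` switches to `O l`, and a vertex left by `s` switches to the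
robot closest to its location in `O`, at an extra cost of at most `2 * nearestCost c O u`. -/
noncomputable def swapChange (c : V → V → ℝ) (Q O : Fin m → V) (l s : Fin m)
    (u : V) : ℝ :=
  (if server c O u = l then nearestCost c O u - nearestCost c Q u else 0)
    + if server c Q u = s then 2 * nearestCost c O u else 0

theorem swapChange_nonneg (hc : IsMetricCost c)
    (hu : nearestCost c Q u ≤ c u (O l)) (s : Fin m) : 0 ≤ swapChange c Q O l s u := by
  refine add_nonneg ?_ ?_
  · split_ifs with hOu
    · rwa [nearestCost_eq_of_mem_W (mem_W_iff.2 hOu), sub_nonneg]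
    · rfl
  · have := hc.nearestCost_nonneg O u
    split_ifs <;> linarith

end Server

section Sums

variable [Fintype V] {w : V → ℝ}

open scoped Classical in
theorem nearestCost_le_of_idle (hc : IsMetricCost c) (hv : v ∈ W c Q i)
    (hidle : ¬ 0 < ∑ u with u ∈ W c Q i, c u (Q i)) (u : V) : nearestCost c Q u ≤ c u v := by
  have hzero : c v (Q i) ≤ 0 := by
    refine le_trans ?_ (not_lt.1 hidle)
    exact Finset.single_le_sum (f := fun u => c u (Q i)) (fun u _ => hc.nonneg u _)
      (by simpa using hv)
  linarith [nearestCost_le c Q u i, hc.triangle u v (Q i)]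

theorem cost_eq_sum_nearestCost (hw : ∀ v, 0 ≤ w v) :
    cost c w Q = ∑ u, w u * nearestCost c Q u :=
  Finset.sum_congr rfl fun u _ => (Real.mul_iInf_of_nonneg (hw u) _).symm

open scoped Classical in
theorem sum_sum_W [Nonempty (Fin m)] (T : Fin m → Prop) (F : Fin m → V → ℝ) :
    ∑ j with T j, ∑ u with u ∈ W c Q j, F j u
      = ∑ u with T (server c Q u), F (server c Q u) u := by
  have hinner : ∀ j, ∑ u with u ∈ W c Q j, F j u
      = ∑ u with server c Q u = j, F (server c Q u) u := fun j => by
    simp only [mem_W_iff]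
    exact Finset.sum_congr rfl fun u hu => by rw [(Finset.mem_filter.1 hu).2]
  simp only [hinner]
  simpa using Finset.sum_fiberwise_eq_sum_filter Finset.univ {j | T j} (server c Q)
    fun u => F (server c Q u) u

/-- The change of the coverage cost that is charged to swapping robot `s` for a robot at `O l`. -/
noncomputable def swapBound [Nonempty (Fin m)] (c : V → V → ℝ) (w : V → ℝ) (Q O : Fin m → V)
    (l s : Fin m) : ℝ :=
  ∑ u, w u * swapChange c Q O l s u

theorem sum_swapBound_le [Nonempty (Fin m)] (hc : IsMetricCost c) (hw : ∀ v, 0 ≤ w v)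
    {s : Fin m → Fin m} (hs : ∀ j, Finset.card {l | s l = j} ≤ 2) :
    ∑ l, swapBound c w Q O l (s l) ≤ 5 * cost c w O - cost c w Q := by
  simp only [swapBound, swapChange, cost_eq_sum_nearestCost hw]
  rw [Finset.sum_comm, Finset.mul_sum, ← Finset.sum_sub_distrib]
  refine Finset.sum_le_sum fun u _ => ?_
  have hcharge : ∑ l, (if server c Q u = s l then 2 * nearestCost c O u else 0)
      ≤ 2 * (2 * nearestCost c O u) := by
    simp only [eq_comm (a := server c Q u)]
    rw [← Finset.sum_filter, Finset.sum_const, nsmul_eq_mul]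
    have := hc.nearestCost_nonneg O u
    gcongr
    exact_mod_cast hs _
  rw [← Finset.mul_sum, Finset.sum_add_distrib, Finset.sum_ite_eq, if_pos (Finset.mem_univ _)]
  calc w u * (nearestCost c O u - nearestCost c Q u + _)
      ≤ w u * (nearestCost c O u - nearestCost c Q u + 2 * (2 * nearestCost c O u)) :=
        mul_le_mul_of_nonneg_left (by gcongr) (hw u)
    _ = 5 * (w u * nearestCost c O u) - w u * nearestCost c Q u := by ring

end Sums

section Swap

variable {N : (Fin m → V) → Fin m → Fin m → Prop}

/-- The sensing cost of `u` by the best neighbour of robot `i` (including `i`) after `i` has moved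
to `v`. -/
noncomputable def movedCost (c : V → V → ℝ) (N : (Fin m → V) → Fin m → Fin m → Prop)
    (Q : Fin m → V) (i : Fin m) (v u : V) : ℝ :=
  ⨅ k : {k // N Q i k}, c u (Function.update Q i v k)

theorem movedCost_le_self (hN : N Q i i) : movedCost c N Q i v u ≤ c u v := by
  simpa [movedCost] using ciInf_le (f := fun k : {k // N Q i k} => c u (Function.update Q i v k))
    (Set.finite_range _).bddBelow ⟨i, hN⟩

theorem movedCost_le (hN : N Q i j) (hj : j ≠ i) : movedCost c N Q i v u ≤ c u (Q j) := by
  simpa [movedCost, hj] using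
    ciInf_le (f := fun k : {k // N Q i k} => c u (Function.update Q i v k))
      (Set.finite_range _).bddBelow ⟨j, hN⟩

theorem IsNeighbourRelation.movedCost_le (hN : IsNeighbourRelation c Q (N Q)) (hu : u ∈ W c Q i)
    (hj : j ≠ i) : movedCost c N Q i v u ≤ c u (Q j) := by
  obtain ⟨j', hij', hne, hle⟩ := hN.exists_other hu hj
  exact (Coverage.movedCost_le hij' hne).trans hle

theorem IsNeighbourRelation.otherCost_le (hN : IsNeighbourRelation c Q (N Q)) (hu : u ∈ W c Q k)
    (hj : j ≠ k) : otherCost c N Q k u ≤ c u (Q j) := by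
  obtain ⟨j', hkj', hne, hle⟩ := hN.exists_other hu hj
  exact (ciInf_le (f := fun j : {j // N Q k j ∧ j ≠ k} => c u (Q j))
    (Set.finite_range _).bddBelow ⟨j', hkj', hne⟩).trans hle

variable [Nonempty (Fin m)]

theorem movedCost_sub_le (hc : IsMetricCost c) (hN : IsNeighbourRelation c Q (N Q))
    (hl : ∀ l', O l' ∈ W c Q i → l' = l) (hu : N Q i (server c Q u)) :
    movedCost c N Q i (O l) u - nearestCost c Q u
      ≤ swapChange c Q O l i u := by
  have hnonneg := hc.nearestCost_nonneg O u
  unfold swapChange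
  by_cases hOu : server c O u = l
  · have hmoved : movedCost c N Q i (O l) u ≤ nearestCost c O u := by
      rw [nearestCost_eq_of_mem_W (mem_W_iff.2 hOu)]
      exact movedCost_le_self (hN.refl i)
    rw [if_pos hOu]
    split_ifs <;> linarith
  rw [if_neg hOu, zero_add]
  split_ifs with hQu
  · have hne : server c Q (O (server c O u)) ≠ i := fun h => hOu (hl _ (mem_W_iff.2 h))
    have := hc.cost_reassign_le Q O u
    linarith [hN.movedCost_le (v := O l) (mem_W_iff.2 hQu) hne]
  · rw [nearestCost_eq c Q, sub_nonpos]
    exact movedCost_le hu hQu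

variable [Fintype V] {w : V → ℝ}

open scoped Classical in
theorem delta_eq (w : V → ℝ) (N : (Fin m → V) → Fin m → Fin m → Prop) (i : Fin m) (v : V) :
    delta c w N Q i v = ∑ u with N Q i (server c Q u),
      w u * (movedCost c N Q i v u - nearestCost c Q u) := by
  simp only [nearestCost_eq]
  exact sum_sum_W (N Q i) fun j u => w u * (movedCost c N Q i v u - c u (Q j))

theorem delta_le_swapBound (hc : IsMetricCost c) (hw : ∀ v, 0 ≤ w v)
    (hN : IsNeighbourRelation c Q (N Q)) (hi : O l ∈ W c Q i)
    (hl : ∀ l', O l' ∈ W c Q i → l' = l) :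
    delta c w N Q i (O l) ≤ swapBound c w Q O l i := by
  classical
  rw [delta_eq, Finset.sum_filter]
  refine Finset.sum_le_sum fun u _ => ?_
  by_cases hu : N Q i (server c Q u)
  · rw [if_pos hu]
    exact mul_le_mul_of_nonneg_left (movedCost_sub_le hc hN hl hu) (hw u)
  · rw [if_neg hu]
    refine mul_nonneg (hw u) (swapChange_nonneg hc ?_ i)
    rw [nearestCost_eq]
    exact not_lt.1 (mt (hN.of_lt (mem_W_server c Q u) hi) hu)

theorem rho_eq (hN : IsNeighbourRelation c Q (N Q)) (hv : v ∈ W c Q i) :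
    rho c w N Q i v = ∑ u, w u * min (c u v - nearestCost c Q u) 0 := by
  classical
  have hterm : ∀ u, (if c u v < nearestCost c Q u then w u * (c u v - nearestCost c Q u) else 0)
      = w u * min (c u v - nearestCost c Q u) 0 := fun u => by
    split_ifs with h
    · rw [min_eq_left (by linarith)]
    · rw [min_eq_right (by linarith), mul_zero]
  simp only [rho, ← Finset.filter_filter]
  simp only [Finset.sum_filter (p := fun u => c u v < _)]
  rw [sum_sum_W (N Q i) fun j u => if c u v < c u (Q j) then w u * (c u v - c u (Q j)) else 0]
  simp only [← nearestCost_eq, hterm]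
  refine Finset.sum_filter_of_ne fun u _ hu => ?_
  refine hN.of_lt (mem_W_server c Q u) hv (not_le.1 fun hle => hu ?_)
  rw [nearestCost_eq, min_eq_right (sub_nonneg.2 hle), mul_zero]

theorem loss_le (hw : ∀ v, 0 ≤ w v) {B : V → ℝ} (hB : ∀ u, 0 ≤ B u)
    (hother : ∀ u ∈ W c Q k, otherCost c N Q k u ≤ c u (Q k) + B u) (n : ℕ) (v : V) :
    (if n = 1 then lossNear c w N Q k v else lossFar c w N Q k)
      ≤ ∑ u, w u * if server c Q u = k then B u else 0 := by
  classical
  have hloss : ∀ u, server c Q u = k → w u * (otherCost c N Q k u - c u (Q k)) ≤ w u * B u :=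
    fun u hu => mul_le_mul_of_nonneg_left
      (sub_le_iff_le_add'.2 (hother u (mem_W_iff.2 hu))) (hw u)
  simp only [mul_ite, mul_zero]
  split_ifs with hn
  · simp only [lossNear, mem_W_iff, Finset.sum_filter]
    refine Finset.sum_le_sum fun u _ => ?_
    by_cases hu : server c Q u = k
    · simp only [hu, true_and, if_true]
      split_ifs
      · exact mul_nonneg (hw u) (hB u)
      · refine le_trans (mul_le_mul_of_nonneg_left ?_ (hw u)) (hloss u hu)
        exact sub_le_sub_right (min_le_left _ _) _
    · simp [hu]
  · simp only [lossFar, mem_W_iff, Finset.sum_filter]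
    refine Finset.sum_le_sum fun u _ => ?_
    split_ifs with hu
    exacts [hloss u hu, le_rfl]

theorem offer_le_swapBound (hc : IsMetricCost c) (hw : ∀ v, 0 ≤ w v)
    (hN : IsNeighbourRelation c Q (N Q)) (hi : O l ∈ W c Q i) (hs : ∀ l', O l' ∉ W c Q s) (n : ℕ) :
    offer c w N Q i n s (O l) ≤ swapBound c w Q O l s := by
  have hgain : rho c w N Q i (O l) ≤
      ∑ u, w u * if server c O u = l then nearestCost c O u - nearestCost c Q u else 0 := by
    rw [rho_eq hN hi]
    refine Finset.sum_le_sum fun u _ => mul_le_mul_of_nonneg_left ?_ (hw u)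
    split_ifs with hu
    · rw [nearestCost_eq_of_mem_W (mem_W_iff.2 hu)]
      exact min_le_left _ _
    · exact min_le_right _ _
  have hother : ∀ u ∈ W c Q s, otherCost c N Q s u ≤ c u (Q s) + 2 * nearestCost c O u := by
    intro u hu
    rw [← nearestCost_eq_of_mem_W hu, add_comm]
    exact (hN.otherCost_le hu fun h => hs _ (mem_W_iff.2 h)).trans (hc.cost_reassign_le Q O u)
  have hloss := loss_le hw (fun u => mul_nonneg zero_le_two (hc.nearestCost_nonneg O u)) hother n
    (O l)
  simp only [swapBound, swapChange, mul_add, Finset.sum_add_distrib]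
  exact add_le_add hgain hloss

theorem neg_le_swapBound {ε₀ : ℝ} (hc : IsMetricCost c) (hw : ∀ v, 0 ≤ w v)
    (hN : IsNeighbourRelation c Q (N Q)) (hε : 0 < ε₀)
    (hQ : ∀ i, ¬ ∃ Q', LocalMove c w N ε₀ i Q Q') (hs : ∀ l', O l' ∈ W c Q s → l' = l) :
    -ε₀ ≤ swapBound c w Q O l s := by
  classical
  set i := server c Q (O l)
  have hi : O l ∈ W c Q i := mem_W_server c Q _
  by_cases hpos : 0 < ∑ u with u ∈ W c Q i, c u (Q i)
  · by_cases hsi : s = i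
    · subst hsi
      exact (neg_lt_delta (hQ _) hpos hi).le.trans (delta_le_swapBound hc hw hN hi hs)
    · obtain ⟨n, hn⟩ := exists_receives (hQ _) hpos (hN.connected i s)
      have hn_pos : 1 ≤ n := by
        refine Nat.one_le_iff_ne_zero.2 ?_
        rintro rfl
        exact hsi hn
      have hs_none : ∀ l', O l' ∉ W c Q s := fun l' hl' =>
        hsi (mem_W_iff.1 (hs l' hl' ▸ hl')).symm
      exact (neg_lt_offer (hQ _) hpos hn_pos hn hi).le.trans
        (offer_le_swapBound hc hw hN hi hs_none n)
  · refine (neg_nonpos.2 hε.le).trans (Finset.sum_nonneg fun u _ => ?_)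
    exact mul_nonneg (hw u) (swapChange_nonneg hc (nearestCost_le_of_idle hc hi hpos u) s)

theorem cost_le_of_not_localMove {ε₀ : ℝ} (hc : IsMetricCost c) (hw : ∀ v, 0 ≤ w v)
    (hN : IsNeighbourRelation c Q (N Q)) (hε : 0 < ε₀)
    (hQ : ∀ i, ¬ ∃ Q', LocalMove c w N ε₀ i Q Q') (O : Fin m → V) :
    cost c w Q ≤ 5 * cost c w O + m * ε₀ := by
  obtain ⟨s, hs, hs_card⟩ := exists_swap_pairing le_rfl fun l => server c Q (O l)
  have hlower : ∑ _l : Fin m, -ε₀ ≤ ∑ l, swapBound c w Q O l (s l) :=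
    Finset.sum_le_sum fun l _ =>
      neg_le_swapBound hc hw hN hε hQ fun l' hl' => hs l l' (mem_W_iff.1 hl')
  have hupper : ∑ l, swapBound c w Q O l (s l) ≤ 5 * cost c w O - cost c w Q :=
    sum_swapBound_le hc hw hs_card
  simp only [Finset.sum_const, Finset.card_univ, Fintype.card_fin, nsmul_eq_mul] at hlower
  linarith

end Swap

theorem eventually_le_of_le_add_mul (a b k : ℝ) :
    ∀ᶠ ε in 𝓝[>] (0 : ℝ), a ≤ b + k * ε → a ≤ b := by
  rcases le_or_gt a b with hab | hab
  · exact Eventually.of_forall fun _ _ => hab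
  · have hlim : Tendsto (fun ε => b + k * ε) (𝓝[>] 0) (𝓝 (b + k * 0)) :=
      tendsto_nhdsWithin_of_tendsto_nhds (Continuous.tendsto (by fun_prop) _)
    filter_upwards [hlim.eventually_lt_const (by simpa using hab)] with ε hε hle
    exact (hle.not_gt hε).elim

theorem approxGuarantee [Fintype V] [Nonempty (Fin m)] {w : V → ℝ}
    {N : (Fin m → V) → Fin m → Fin m → Prop} (hc : IsMetricCost c) (hw : ∀ v, 0 ≤ w v)
    (hN : ∀ Q, IsNeighbourRelation c Q (N Q)) : ApproxGuarantee c w N := by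
  have hbound : ∀ ε₀ : ℝ, 0 < ε₀ → ∀ Q₀ Q O : Fin m → V, TerminatesAt c w N ε₀ Q₀ Q →
      IsOptimal c w O → cost c w Q ≤ 5 * cost c w O + m * ε₀ := fun ε₀ hε Q₀ Q O hterm _ =>
    cost_le_of_not_localMove hc hw (hN Q) hε hterm.not_localMove O
  have hexact : ∀ᶠ ε₀ in 𝓝[>] (0 : ℝ), ∀ Q O : Fin m → V,
      cost c w Q ≤ 5 * cost c w O + m * ε₀ → cost c w Q ≤ 5 * cost c w O :=
    eventually_all.2 fun Q => eventually_all.2 fun O => eventually_le_of_le_add_mul _ _ _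
  refine ⟨hbound, fun _ => 0, isLittleO_zero _ _, ?_⟩
  filter_upwards [hexact, self_mem_nhdsWithin] with ε₀ h hε Q₀ Q O hterm hopt
  rw [add_zero]
  exact h Q O (hbound ε₀ hε Q₀ Q O hterm hopt)

end Analysis

section Environment

theorem reflTransGen_of_isClosed_cover {X ι : Type*} [TopologicalSpace X] [PreconnectedSpace X]
    [Finite ι] {F : ι → Set X} (hclosed : ∀ i, IsClosed (F i)) (hne : ∀ i, (F i).Nonempty)
    (hcover : ∀ x, ∃ i, x ∈ F i) (i k : ι) :
    Relation.ReflTransGen (fun a b => (F a ∩ F b).Nonempty) i k := by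
  by_contra hk
  let C : Set ι := {j | Relation.ReflTransGen (fun a b => (F a ∩ F b).Nonempty) i j}
  have hclosed_union : ∀ T : Set ι, IsClosed (⋃ j ∈ T, F j) := fun T =>
    T.toFinite.isClosed_biUnion fun j _ => hclosed j
  have hcover_union : Set.univ ⊆ (⋃ j ∈ C, F j) ∪ ⋃ j ∈ Cᶜ, F j := by
    rw [← Set.biUnion_union, Set.union_compl_self, Set.biUnion_univ]
    exact fun x _ => Set.mem_iUnion.2 (hcover x)
  obtain ⟨x, hx⟩ := hne i
  obtain ⟨y, hy⟩ := hne k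
  obtain ⟨z, -, hzC, hzC'⟩ := isPreconnected_closed_iff.1 isPreconnected_univ _ _
    (hclosed_union C) (hclosed_union Cᶜ) hcover_union
    ⟨x, trivial, Set.mem_biUnion (Relation.ReflTransGen.refl : i ∈ C) hx⟩
    ⟨y, trivial, Set.mem_biUnion (show k ∈ Cᶜ from hk) hy⟩
  obtain ⟨a, ha, hza⟩ := Set.mem_iUnion₂.1 hzC
  obtain ⟨b, hb, hzb⟩ := Set.mem_iUnion₂.1 hzC'
  exact hb (Relation.ReflTransGen.tail ha ⟨z, hza, hzb⟩)

variable {X : Type*} [MetricSpace X]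

theorem IsGeodesic.exists_path (hX : IsGeodesic X) (p q : X) :
    ∃ γ : ℝ → X, γ 0 = p ∧ γ (dist p q) = q ∧ ContinuousOn γ (Set.Icc 0 (dist p q)) ∧
      ∀ s ∈ Set.Icc 0 (dist p q), dist p (γ s) + dist (γ s) q = dist p q := by
  obtain ⟨γ, hp, hq, hγ⟩ := hX p q
  refine ⟨γ, hp, hq, ?_, fun s hs => ?_⟩
  · exact (LipschitzOnWith.of_dist_le_mul (K := 1) fun s hs t ht => by
      simp [hγ s hs t ht, Real.dist_eq]).continuousOn
  · have hleft := hγ 0 (Set.left_mem_Icc.2 dist_nonneg) s hs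
    have hright := hγ s hs _ (Set.right_mem_Icc.2 dist_nonneg)
    rw [hp, abs_sub_comm, sub_zero, abs_of_nonneg hs.1] at hleft
    rw [hq, abs_sub_comm, abs_of_nonneg (sub_nonneg.2 hs.2)] at hright
    linarith

theorem IsGeodesic.preconnectedSpace (hX : IsGeodesic X) : PreconnectedSpace X := by
  refine ⟨isPreconnected_of_forall_pair fun p _ q _ => ?_⟩
  obtain ⟨γ, hp, hq, hγ, -⟩ := hX.exists_path p q
  exact ⟨γ '' Set.Icc 0 (dist p q), Set.subset_univ _, ⟨0, by simp, hp⟩,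
    ⟨dist p q, by simp, hq⟩, isPreconnected_Icc.image _ hγ⟩

theorem IsGeodesic.exists_equidistant (hX : IsGeodesic X) {p a b : X} (h : dist p a ≤ dist p b) :
    ∃ x, dist x a = dist x b ∧ dist p x + dist x b = dist p b := by
  obtain ⟨γ, hp, hb, hγ, hbetween⟩ := hX.exists_path p b
  obtain ⟨s, hs, heq⟩ :
      (0 : ℝ) ∈ (fun s => dist (γ s) a - dist (γ s) b) '' Set.Icc 0 (dist p b) := by
    refine intermediate_value_Icc dist_nonneg (by fun_prop) ⟨?_, ?_⟩
    · simpa [hp] using h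
    · simp [hb]
  exact ⟨γ s, sub_eq_zero.1 heq, hbetween s hs⟩

variable {S : Finset X} {m : ℕ} {Q : Fin m → S} {f : ℝ → ℝ} {i j k : Fin m} {p q : X} {u : S}

theorem isClosed_voronoi (Q : Fin m → S) (i : Fin m) : IsClosed (voronoi Q i) := by
  simp only [voronoi, Set.ofPred_forall]
  exact isClosed_iInter fun j => isClosed_le (by fun_prop) (by fun_prop)

theorem IsGeodesic.voronoi_inter_nonempty (hX : IsGeodesic X) (hk : p ∈ voronoi Q k)
    (hj : IsClosestIn (fun p i => dist p (Q i : X)) {k}ᶜ p j) :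
    (voronoi Q k ∩ voronoi Q j).Nonempty := by
  obtain ⟨x, heq, hbetween⟩ := hX.exists_equidistant (hk j)
  have hx := hj.of_between dist_triangle hbetween.le
  have hxj : x ∈ voronoi Q j := fun l => by
    by_cases hl : l = k
    · rw [hl, heq]
    · exact (hx.2 l hl).1
  exact ⟨x, fun l => heq ▸ hxj l, hxj⟩

theorem envCost_le_iff (hf : StrictMonoOn f (Set.Ici 0)) {u v u' v' : S} :
    envCost S f u v ≤ envCost S f u' v' ↔ dist (u : X) v ≤ dist (u' : X) v' :=
  hf.le_iff_le dist_nonneg dist_nonneg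

theorem mem_voronoi_of_mem_W (hf : StrictMonoOn f (Set.Ici 0)) (hu : u ∈ W (envCost S f) Q i) :
    (u : X) ∈ voronoi Q i :=
  fun j => (envCost_le_iff hf).1 (hu j).1

theorem isMetricCost_envCost (S : Finset X) (hf : MonotoneOn f (Set.Ici 0))
    (hsub : ∀ x y, 0 ≤ x → 0 ≤ y → f (x + y) ≤ f x + f y) : IsMetricCost (envCost S f) where
  symm u v := by rw [envCost, dist_comm, envCost]
  triangle u v x :=
    (hf dist_nonneg (add_nonneg dist_nonneg dist_nonneg) (dist_triangle _ (v : X) _)).trans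
      (hsub _ _ dist_nonneg dist_nonneg)

theorem voronoiRadius_nonneg (Q : Fin m → S) (i : Fin m) : 0 ≤ voronoiRadius Q i :=
  Real.sSup_nonneg (by rintro _ ⟨p, -, rfl⟩; exact dist_nonneg)

variable [BoundedSpace X]

theorem dist_le_voronoiRadius (hp : p ∈ voronoi Q i) : dist p (Q i) ≤ voronoiRadius Q i := by
  refine le_csSup ⟨Metric.diam (Set.univ : Set X), ?_⟩ ⟨p, hp, rfl⟩
  rintro _ ⟨x, -, rfl⟩
  exact Metric.dist_le_diam_of_mem (Bornology.IsBounded.all _) trivial trivial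

theorem envNeighbour_of_dist_le (hp : p ∈ voronoi Q i) (hq : q ∈ voronoi Q j)
    (hpq : dist p q ≤ dist q (Q j)) : EnvNeighbour Q i j := by
  have hpath := dist_triangle4 (Q i : X) p q (Q j)
  rw [dist_comm _ p] at hpath
  have hi := (dist_le_voronoiRadius hp).trans (le_max_left _ (voronoiRadius Q j))
  have hj := (dist_le_voronoiRadius hq).trans (le_max_right (voronoiRadius Q i) _)
  have hmax := (voronoiRadius_nonneg Q i).trans (le_max_left _ (voronoiRadius Q j))
  unfold EnvNeighbour
  linarith

theorem envNeighbour_of_inter_nonempty (h : (voronoi Q i ∩ voronoi Q j).Nonempty) :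
    EnvNeighbour Q i j := by
  obtain ⟨p, hi, hj⟩ := h
  exact envNeighbour_of_dist_le hi hj (by simp)

theorem isNeighbourRelation_env [Nonempty (Fin m)] (hX : IsGeodesic X)
    (hf : StrictMonoOn f (Set.Ici 0)) (Q : Fin m → S) :
    IsNeighbourRelation (envCost S f) Q (EnvNeighbour Q) where
  refl i := envNeighbour_of_inter_nonempty ⟨Q i, fun j => by simp, fun j => by simp⟩
  of_lt {i j u v} hu hv hlt := by
    refine envNeighbour_of_dist_le (mem_voronoi_of_mem_W hf hv) (mem_voronoi_of_mem_W hf hu) ?_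
    rw [dist_comm]
    exact (envCost_le_iff hf).1 hlt.le
  exists_other {k j u} hu hj := by
    obtain ⟨j', hj'⟩ := exists_isClosestIn (fun p i => dist p (Q i : X)) (T := {k}ᶜ) ⟨j, hj⟩ u
    have hinter := hX.voronoi_inter_nonempty (mem_voronoi_of_mem_W hf hu) hj'
    exact ⟨j', envNeighbour_of_inter_nonempty hinter, hj'.1, (envCost_le_iff hf).2 (hj'.2 j hj).1⟩
  connected i k := by
    have := hX.preconnectedSpace
    refine Relation.ReflTransGen.mono (fun _ _ => envNeighbour_of_inter_nonempty) i k
      (reflTransGen_of_isClosed_cover (isClosed_voronoi Q) (fun i => ⟨Q i, fun j => by simp⟩)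
        (fun p => ?_) i k)
    exact ⟨_, fun l => (mem_cell_owner (fun (p : X) j => dist p (Q j)) p l).1⟩

end Environment

section GraphDist

variable {P : Type*} {H : SimpleGraph P} {len : P → P → ℝ}

/-- The length of a walk, so that `graphDist` is the infimum of `walkLen` over all walks. -/
def walkLen (len : P → P → ℝ) {a b : P} (p : H.Walk a b) : ℝ :=
  (p.darts.map fun d => len d.fst d.snd).sum

theorem walkLen_cons {a b t : P} (h : H.Adj a b) (p : H.Walk b t) :
    walkLen len (.cons h p) = len a b + walkLen len p := by
  simp [walkLen]

theorem walkLen_append {a b t : P} (p : H.Walk a b) (q : H.Walk b t) :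
    walkLen len (p.append q) = walkLen len p + walkLen len q := by
  simp [walkLen]

theorem walkLen_reverse (hsymm : ∀ x y, len x y = len y x) {a b : P} (p : H.Walk a b) :
    walkLen len p.reverse = walkLen len p := by
  simp only [walkLen, SimpleGraph.Walk.darts_reverse, List.map_reverse, List.sum_reverse,
    List.map_map]
  exact congrArg List.sum (List.map_congr_left fun d _ => hsymm _ _)

theorem graphDist_comm (hsymm : ∀ x y, len x y = len y x) (a b : P) :
    graphDist H len a b = graphDist H len b a :=
  Function.Surjective.iInf_congr SimpleGraph.Walk.reverse
    (fun p => ⟨p.reverse, p.reverse_reverse⟩) fun p => walkLen_reverse hsymm p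

theorem le_graphDist_add (hH : H.Preconnected) {h : P → ℝ}
    (hh : ∀ a b, H.Adj a b → h a ≤ len a b + h b) (a b : P) :
    h a ≤ graphDist H len a b + h b := by
  have hwalk : ∀ {a} (p : H.Walk a b), h a ≤ walkLen len p + h b := by
    intro a p
    induction p with
    | nil => simp [walkLen]
    | @cons a d b hadj p ih =>
      rw [walkLen_cons, add_assoc]
      exact (hh a d hadj).trans (by gcongr)
  have : Nonempty (H.Walk a b) := hH a b
  exact sub_le_iff_le_add.1 (le_ciInf fun p => sub_le_iff_le_add.2 (hwalk p))

theorem walkLen_nonneg (hnn : ∀ x y, H.Adj x y → 0 ≤ len x y) {a b : P} (p : H.Walk a b) :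
    0 ≤ walkLen len p := by
  refine List.sum_nonneg fun r hr => ?_
  obtain ⟨d, -, rfl⟩ := List.mem_map.1 hr
  exact hnn _ _ d.adj

theorem graphDist_le_walkLen (hnn : ∀ x y, H.Adj x y → 0 ≤ len x y) {a b : P} (p : H.Walk a b) :
    graphDist H len a b ≤ walkLen len p :=
  ciInf_le ⟨0, by rintro _ ⟨q, rfl⟩; exact walkLen_nonneg hnn q⟩ p

theorem graphDist_nonneg (hnn : ∀ x y, H.Adj x y → 0 ≤ len x y) (a b : P) :
    0 ≤ graphDist H len a b :=
  Real.iInf_nonneg fun p => walkLen_nonneg hnn p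

theorem graphDist_self (hnn : ∀ x y, H.Adj x y → 0 ≤ len x y) (a : P) :
    graphDist H len a a = 0 :=
  le_antisymm (graphDist_le_walkLen hnn .nil) (graphDist_nonneg hnn a a)

theorem graphDist_le_of_adj (hnn : ∀ x y, H.Adj x y → 0 ≤ len x y) {a b : P} (h : H.Adj a b) :
    graphDist H len a b ≤ len a b :=
  (graphDist_le_walkLen hnn (.cons h .nil)).trans_eq (by simp [walkLen])

theorem graphDist_triangle (hH : H.Preconnected) (hnn : ∀ x y, H.Adj x y → 0 ≤ len x y)
    (a b t : P) : graphDist H len a t ≤ graphDist H len a b + graphDist H len b t := by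
  have : Nonempty (H.Walk a b) := hH a b
  have : Nonempty (H.Walk b t) := hH b t
  exact le_ciInf_add_ciInf fun p q =>
    (graphDist_le_walkLen hnn (p.append q)).trans_eq (walkLen_append p q)

theorem exists_walkLen_eq_graphDist [Finite P] (hH : H.Preconnected)
    (hnn : ∀ x y, H.Adj x y → 0 ≤ len x y) (a b : P) :
    ∃ p : H.Walk a b, walkLen len p = graphDist H len a b := by
  classical
  have := Fintype.ofFinite P
  obtain ⟨p₀⟩ := hH a b
  have : Nonempty (H.Walk a b) := ⟨p₀⟩
  have : Nonempty (H.Path a b) := ⟨p₀.toPath⟩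
  obtain ⟨p, hmin⟩ := Finite.exists_min fun p : H.Path a b => walkLen len p.1
  have hbypass : ∀ q : H.Walk a b, walkLen len q.bypass ≤ walkLen len q := fun q =>
    (q.darts_bypass_sublist_darts.map _).sum_le_sum fun r hr => by
      obtain ⟨d, -, rfl⟩ := List.mem_map.1 hr
      exact hnn _ _ d.adj
  exact ⟨p.1, le_antisymm (le_ciInf fun q => (hmin q.toPath).trans (hbypass q))
    (graphDist_le_walkLen hnn p.1)⟩

theorem graphDist_add_graphDist_le_of_mem_support (hnn : ∀ x y, H.Adj x y → 0 ≤ len x y)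
    {a b t : P} {p : H.Walk a t} (hp : walkLen len p = graphDist H len a t) (hb : b ∈ p.support) :
    graphDist H len a b + graphDist H len b t ≤ graphDist H len a t := by
  obtain ⟨q, r, rfl⟩ := SimpleGraph.Walk.mem_support_iff_exists_append.1 hb
  rw [← hp, walkLen_append]
  exact add_le_add (graphDist_le_walkLen hnn q) (graphDist_le_walkLen hnn r)

/-- Follow a shortest walk from `a` to robot `j`: `j` stays the closest robot other than `k` all the
way, so the first vertex outside the cell of `k` is in the cell of `j`. -/
theorem exists_adj_cells [Finite P] (hH : H.Preconnected) (hnn : ∀ x y, H.Adj x y → 0 ≤ len x y)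
    {m : ℕ} {x : Fin m → P} {a : P} {j k : Fin m}
    (ha : a ∈ cell (fun p i => graphDist H len p (x i)) k)
    (hj : IsClosestIn (fun p i => graphDist H len p (x i)) {k}ᶜ a j)
    (hxj : x j ∉ cell (fun p i => graphDist H len p (x i)) k) :
    ∃ b b', H.Adj b b' ∧ b ∈ cell (fun p i => graphDist H len p (x i)) k ∧
      b' ∈ cell (fun p i => graphDist H len p (x i)) j := by
  obtain ⟨p, hp⟩ := exists_walkLen_eq_graphDist hH hnn a (x j)
  obtain ⟨d, hd, hfst, hsnd⟩ := p.exists_boundary_dart _ ha hxj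
  have hbetween := graphDist_add_graphDist_le_of_mem_support hnn hp
    (p.dart_snd_mem_support_of_mem_darts hd)
  exact ⟨d.fst, d.snd, d.adj, hfst,
    (hj.of_between (graphDist_triangle hH hnn) hbetween).mem_cell hsnd⟩

end GraphDist

section Graph

variable {V : Type*} {G : SimpleGraph V} {len : Sym2 V → ℝ}

theorem subdivision_preconnected (hG : G.Preconnected) : (subdivision G).Preconnected := by
  have hadj : ∀ {u x}, G.Adj u x → (subdivision G).Reachable (.inl u) (.inl x) := fun {u x} h => by
    let e : G.edgeSet := ⟨s(u, x), h⟩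
    have hu : (subdivision G).Adj (.inl u) (.inr e) := Sym2.mem_mk_left u x
    have hx : (subdivision G).Adj (.inr e) (.inl x) := Sym2.mem_mk_right u x
    exact hu.reachable.trans hx.reachable
  have hinl : ∀ u v, (subdivision G).Reachable (.inl u) (.inl v) := fun u v => by
    obtain ⟨p⟩ := hG u v
    induction p with
    | nil => exact .rfl
    | cons h _ ih => exact (hadj h).trans ih
  have hexists : ∀ p, ∃ u, (subdivision G).Reachable p (.inl u) := by
    rintro (u | e)
    · exact ⟨u, .rfl⟩
    · have h : (subdivision G).Adj (.inr e) (.inl e.1.out.1) := e.1.out_fst_mem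
      exact ⟨_, h.reachable⟩
  intro p q
  obtain ⟨u, hu⟩ := hexists p
  obtain ⟨v, hv⟩ := hexists q
  exact hu.trans ((hinl u v).trans hv.symm)

theorem subdivisionLen_nonneg (hlen : ∀ e ∈ G.edgeSet, 0 ≤ len e) (p q : V ⊕ G.edgeSet) :
    0 ≤ subdivisionLen G len p q := by
  have hhalf : ∀ e : G.edgeSet, 0 ≤ len e / 2 := fun e => div_nonneg (hlen e e.2) zero_le_two
  rcases p with _ | e <;> rcases q with _ | e'
  exacts [le_rfl, hhalf e', hhalf e, le_rfl]

theorem subdivisionLen_comm (p q : V ⊕ G.edgeSet) :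
    subdivisionLen G len p q = subdivisionLen G len q p := by
  rcases p with _ | _ <;> rcases q with _ | _ <;> rfl

theorem graphCost_comm (u v : V) : graphCost G len u v = graphCost G len v u :=
  graphDist_comm (fun x y => by rw [Sym2.eq_swap]) u v

theorem graphCost_triangle (hG : G.Preconnected) (hlen : ∀ e ∈ G.edgeSet, 0 ≤ len e) (u v x : V) :
    graphCost G len u x ≤ graphCost G len u v + graphCost G len v x :=
  graphDist_triangle hG (fun _ _ h => hlen _ h) u v x

theorem graphCost_self (hlen : ∀ e ∈ G.edgeSet, 0 ≤ len e) (u : V) : graphCost G len u u = 0 :=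
  graphDist_self (fun _ _ h => hlen _ h) u

theorem isMetricCost_graphCost (hG : G.Preconnected) (hlen : ∀ e ∈ G.edgeSet, 0 ≤ len e) :
    IsMetricCost (graphCost G len) :=
  ⟨graphCost_comm, graphCost_triangle hG hlen⟩

theorem graphCost_nonneg (hlen : ∀ e ∈ G.edgeSet, 0 ≤ len e) (u v : V) : 0 ≤ graphCost G len u v :=
  graphDist_nonneg (fun _ _ h => hlen _ h) u v

theorem graphCost_le_of_mem_edge (hlen : ∀ e ∈ G.edgeSet, 0 ≤ len e) {e : Sym2 V}
    (he : e ∈ G.edgeSet) {u x : V} (hu : u ∈ e) (hx : x ∈ e) : graphCost G len u x ≤ len e := by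
  by_cases hux : u = x
  · exact hux ▸ (graphCost_self hlen u).trans_le (hlen e he)
  · obtain rfl := (Sym2.mem_and_mem_iff hux).1 ⟨hu, hx⟩
    exact graphDist_le_of_adj (fun _ _ h => hlen _ h) he

theorem graphDist_subdivision_le (hG : G.Preconnected) (hlen : ∀ e ∈ G.edgeSet, 0 ≤ len e)
    (u v : V) :
    graphDist (subdivision G) (subdivisionLen G len) (.inl u) (.inl v) ≤ graphCost G len u v := by
  have hH := subdivision_preconnected hG
  have hnn := fun p q (_ : (subdivision G).Adj p q) => subdivisionLen_nonneg hlen p q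
  have hstep : ∀ u x, G.Adj u x →
      graphDist (subdivision G) (subdivisionLen G len) (.inl u) (.inl v) ≤ len s(u, x) +
        graphDist (subdivision G) (subdivisionLen G len) (.inl x) (.inl v) := by
    intro u x h
    let e : G.edgeSet := ⟨s(u, x), h⟩
    have hu : (subdivision G).Adj (.inl u) (.inr e) := Sym2.mem_mk_left u x
    have hx : (subdivision G).Adj (.inr e) (.inl x) := Sym2.mem_mk_right u x
    have hue : _ ≤ len s(u, x) / 2 := graphDist_le_of_adj hnn hu
    have hex : _ ≤ len s(u, x) / 2 := graphDist_le_of_adj hnn hx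
    have huv := graphDist_triangle hH hnn (.inl u) (.inr e) (.inl v)
    have hev := graphDist_triangle hH hnn (.inr e) (.inl x) (.inl v)
    linarith
  simpa [graphDist_self hnn, graphCost] using le_graphDist_add hG hstep u v

theorem graphCost_le_graphDist_subdivision (hG : G.Preconnected)
    (hlen : ∀ e ∈ G.edgeSet, 0 ≤ len e) (u v : V) :
    graphCost G len u v ≤ graphDist (subdivision G) (subdivisionLen G len) (.inl u) (.inl v) := by
  let h : V ⊕ G.edgeSet → ℝ :=
    Sum.elim (graphCost G len · v) fun e => len e / 2 + ⨅ x : {x // x ∈ e.1}, graphCost G len x v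
  have hstep : ∀ p q, (subdivision G).Adj p q → h p ≤ subdivisionLen G len p q + h q := by
    rintro (x | e) (y | e') hadj
    · exact hadj.elim
    · have : Nonempty {x // x ∈ e'.1} := ⟨x, hadj⟩
      have hx : graphCost G len x v - len e' ≤ ⨅ x : {x // x ∈ e'.1}, graphCost G len x v :=
        le_ciInf fun y => by
          have hxy := graphCost_le_of_mem_edge hlen e'.2 hadj y.2
          linarith [graphCost_triangle hG hlen x y v]
      simp only [h, subdivisionLen, Sum.elim_inl, Sum.elim_inr]
      linarith
    · have hbdd : BddBelow (Set.range fun x : {x // x ∈ e.1} => graphCost G len x v) :=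
        ⟨0, by rintro _ ⟨x, rfl⟩; exact graphCost_nonneg hlen _ _⟩
      exact add_le_add_right (ciInf_le hbdd ⟨y, hadj⟩) _
    · exact hadj.elim
  simpa [h, graphCost_self hlen] using
    le_graphDist_add (subdivision_preconnected hG) hstep (.inl u) (.inl v)

theorem graphDist_subdivision (hG : G.Preconnected) (hlen : ∀ e ∈ G.edgeSet, 0 ≤ len e) (u v : V) :
    graphDist (subdivision G) (subdivisionLen G len) (.inl u) (.inl v) = graphCost G len u v :=
  le_antisymm (graphDist_subdivision_le hG hlen u v)
    (graphCost_le_graphDist_subdivision hG hlen u v)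

variable {m : ℕ} {Q : Fin m → V} {i j : Fin m} {u v : V} {p q : V ⊕ G.edgeSet}

theorem half_len_le_robotDist (hG : G.Preconnected) (hlen : ∀ e ∈ G.edgeSet, 0 ≤ len e)
    (e : G.edgeSet) (j : Fin m) : len e / 2 ≤ robotDist G len Q (.inr e) j := by
  let h : V ⊕ G.edgeSet → ℝ := Sum.elim (fun _ => 0) fun e => len e / 2
  have hstep : ∀ p q, (subdivision G).Adj p q → h p ≤ subdivisionLen G len p q + h q := by
    rintro (x | e) (y | e') hadj
    · exact hadj.elim
    · have := hlen e' e'.2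
      simp only [h, subdivisionLen, Sum.elim_inl, Sum.elim_inr]
      linarith
    · exact (add_zero _).ge
    · exact hadj.elim
  simpa [h, robotDist] using
    le_graphDist_add (subdivision_preconnected hG) hstep (.inr e) (.inl (Q j))

theorem inl_mem_cell_iff (hG : G.Preconnected) (hlen : ∀ e ∈ G.edgeSet, 0 ≤ len e) :
    .inl u ∈ cell (robotDist G len Q) i ↔ u ∈ W (graphCost G len) Q i := by
  simp only [W, cell, robotDist, graphDist_subdivision hG hlen, Set.mem_ofPred_eq]

theorem cellRadius_nonneg (hlen : ∀ e ∈ G.edgeSet, 0 ≤ len e) (Q : Fin m → V) (i : Fin m) :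
    0 ≤ cellRadius G len Q i := by
  refine Real.sSup_nonneg ?_
  rintro _ ⟨p, -, rfl⟩
  exact graphDist_nonneg (fun p q _ => subdivisionLen_nonneg hlen p q) _ _

theorem GraphNeighbour.symm (h : GraphNeighbour G len Q i j) : GraphNeighbour G len Q j i := by
  rwa [GraphNeighbour, max_comm, graphCost_comm]

variable [Finite V]

theorem robotDist_le_cellRadius (hp : p ∈ cell (robotDist G len Q) i) :
    robotDist G len Q p i ≤ cellRadius G len Q i :=
  le_csSup (Set.toFinite _).bddAbove ⟨p, hp, rfl⟩

theorem graphCost_le_cellRadius (hG : G.Preconnected) (hlen : ∀ e ∈ G.edgeSet, 0 ≤ len e)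
    (hu : u ∈ W (graphCost G len) Q i) : graphCost G len u (Q i) ≤ cellRadius G len Q i := by
  rw [← graphDist_subdivision hG hlen]
  exact robotDist_le_cellRadius ((inl_mem_cell_iff hG hlen).2 hu)

theorem graphNeighbour_of_graphCost_le (hG : G.Preconnected) (hlen : ∀ e ∈ G.edgeSet, 0 ≤ len e)
    (hu : u ∈ W (graphCost G len) Q i) (hv : v ∈ W (graphCost G len) Q j)
    (huv : graphCost G len u v ≤ graphCost G len v (Q j)) : GraphNeighbour G len Q i j := by
  have hpath := graphCost_triangle hG hlen (Q i) u (Q j)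
  have hpath' := graphCost_triangle hG hlen u v (Q j)
  rw [graphCost_comm (Q i) u] at hpath
  have hi := (graphCost_le_cellRadius hG hlen hu).trans (le_max_left _ (cellRadius G len Q j))
  have hj := (graphCost_le_cellRadius hG hlen hv).trans (le_max_right (cellRadius G len Q i) _)
  have hmax := (cellRadius_nonneg hlen Q i).trans (le_max_left _ (cellRadius G len Q j))
  unfold GraphNeighbour
  linarith

theorem graphNeighbour_of_mem_W (hG : G.Preconnected) (hlen : ∀ e ∈ G.edgeSet, 0 ≤ len e)
    (h : Q j ∈ W (graphCost G len) Q i) : GraphNeighbour G len Q i j := by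
  have hi := (graphCost_le_cellRadius hG hlen h).trans (le_max_left _ (cellRadius G len Q j))
  have hmax := (cellRadius_nonneg hlen Q i).trans (le_max_left _ (cellRadius G len Q j))
  rw [GraphNeighbour, graphCost_comm]
  linarith

theorem graphNeighbour_of_adj (hG : G.Preconnected) (hlen : ∀ e ∈ G.edgeSet, 0 ≤ len e)
    (hpq : (subdivision G).Adj p q) (hp : p ∈ cell (robotDist G len Q) i)
    (hq : q ∈ cell (robotDist G len Q) j) : GraphNeighbour G len Q i j := by
  have hH := subdivision_preconnected hG
  have hnn := fun p q (_ : (subdivision G).Adj p q) => subdivisionLen_nonneg hlen p q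
  let r := max (cellRadius G len Q i) (cellRadius G len Q j)
  have hi : robotDist G len Q p i ≤ r := (robotDist_le_cellRadius hp).trans (le_max_left _ _)
  have hj : robotDist G len Q q j ≤ r := (robotDist_le_cellRadius hq).trans (le_max_right _ _)
  have hstep : subdivisionLen G len p q ≤ r := by
    rcases p with _ | e <;> rcases q with _ | e'
    · exact hpq.elim
    · exact (half_len_le_robotDist hG hlen e' j).trans hj
    · exact (half_len_le_robotDist hG hlen e i).trans hi
    · exact hpq.elim
  have hmax : 0 ≤ r := (cellRadius_nonneg hlen Q i).trans (le_max_left _ _)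
  calc graphCost G len (Q i) (Q j)
      = graphDist (subdivision G) (subdivisionLen G len) (.inl (Q i)) (.inl (Q j)) :=
        (graphDist_subdivision hG hlen _ _).symm
    _ ≤ graphDist (subdivision G) (subdivisionLen G len) (.inl (Q i)) p +
          (graphDist (subdivision G) (subdivisionLen G len) p q + robotDist G len Q q j) :=
        (graphDist_triangle hH hnn _ p _).trans
          (add_le_add_right (graphDist_triangle hH hnn p q _) _)
    _ ≤ r + (r + r) := by
        rw [graphDist_comm subdivisionLen_comm (.inl (Q i)) p]
        exact add_le_add hi (add_le_add ((graphDist_le_of_adj hnn hpq).trans hstep) hj)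
    _ ≤ 4 * r := by linarith

theorem isNeighbourRelation_graph [Nonempty (Fin m)] (hG : G.Preconnected)
    (hlen : ∀ e ∈ G.edgeSet, 0 ≤ len e) (Q : Fin m → V) :
    IsNeighbourRelation (graphCost G len) Q (GraphNeighbour G len Q) where
  refl i := by
    have hradius := cellRadius_nonneg hlen Q i
    simpa [GraphNeighbour, graphCost_self hlen] using hradius
  of_lt {i j u v} hu hv hlt := by
    refine graphNeighbour_of_graphCost_le hG hlen hv hu ?_
    rw [graphCost_comm]
    exact hlt.le
  exists_other {k j u} hu hj := by
    obtain ⟨j', hj'⟩ := exists_isClosestIn (robotDist G len Q) (T := {k}ᶜ) ⟨j, hj⟩ (.inl u)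
    have hle := (hj'.2 j hj).1
    simp only [robotDist, graphDist_subdivision hG hlen] at hle
    refine ⟨j', ?_, hj'.1, hle⟩
    by_cases hQ : .inl (Q j') ∈ cell (robotDist G len Q) k
    · exact graphNeighbour_of_mem_W hG hlen ((inl_mem_cell_iff hG hlen).1 hQ)
    · obtain ⟨p, q, hpq, hp, hq⟩ := exists_adj_cells (subdivision_preconnected hG)
        (fun p q _ => subdivisionLen_nonneg hlen p q) ((inl_mem_cell_iff hG hlen).2 hu) hj' hQ
      exact graphNeighbour_of_adj hG hlen hpq hp hq
  connected i k := by
    have hwalk := (SimpleGraph.reachable_iff_reflTransGen _ _).1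
      (subdivision_preconnected hG (.inl (Q i)) (.inl (Q k)))
    have hcells := Relation.ReflTransGen.lift (p := GraphNeighbour G len Q)
      (owner (robotDist G len Q)) (fun p q hpq =>
        graphNeighbour_of_adj hG hlen hpq (mem_cell_owner _ p) (mem_cell_owner _ q)) _ _ hwalk
    have hself : ∀ l, GraphNeighbour G len Q (owner (robotDist G len Q) (.inl (Q l))) l :=
      fun l => graphNeighbour_of_mem_W hG hlen ((inl_mem_cell_iff hG hlen).1 (mem_cell_owner _ _))
    exact Relation.ReflTransGen.head (hself i).symm (hcells.tail (hself k))

end Graph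
end Coverage

theorem theorem2_general (m : ℕ) (hm : 0 < m) :
    (∀ (V : Type*) [Fintype V] (G : SimpleGraph V) (len : Sym2 V → ℝ) (w : V → ℝ),
      G.Connected → (∀ e ∈ G.edgeSet, 0 ≤ len e) → (∀ v, 0 ≤ w v) →
      Coverage.ApproxGuarantee (m := m) (Coverage.graphCost G len) w
        (Coverage.GraphNeighbour G len)) ∧
    (∀ (X : Type*) [MetricSpace X] [BoundedSpace X] (S : Finset X) (f : ℝ → ℝ) (w : S → ℝ),
      Coverage.IsGeodesic X → StrictMonoOn f (Set.Ici 0) →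
      (∀ x y, 0 ≤ x → 0 ≤ y → f (x + y) ≤ f x + f y) → (∀ v, 0 ≤ w v) →
      Coverage.ApproxGuarantee (m := m) (Coverage.envCost S f) w Coverage.EnvNeighbour) := by
  have : Nonempty (Fin m) := ⟨⟨0, hm⟩⟩
  refine ⟨fun V _ G len w hG hlen hw => ?_, fun X _ _ S f w hX hf hsub hw => ?_⟩
  · exact Coverage.approxGuarantee (Coverage.isMetricCost_graphCost hG.preconnected hlen) hw
      (Coverage.isNeighbourRelation_graph hG.preconnected hlen)
  · exact Coverage.approxGuarantee (Coverage.isMetricCost_envCost S hf.monotoneOn hsub) hw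
      (Coverage.isNeighbourRelation_env hX hf)

theorem theorem2 (m : ℕ) (hm : 0 < m) :
    -- a metric graph, with neighbours defined through the graph
    (∀ (V : Type*) [Fintype V] (G : SimpleGraph V) (len : Sym2 V → ℝ) (w : V → ℝ),
      G.Connected → (∀ e ∈ G.edgeSet, 0 ≤ len e) → (∀ v, 0 ≤ w v) →
      Coverage.ApproxGuarantee (m := m) (Coverage.graphCost G len) w
        (Coverage.GraphNeighbour G len)) ∧
    -- the metric graph of a finite sample of a continuous environment, with neighbours defined
    -- through the environment, for an increasing subadditive sensing function
    (∀ (X : Type*) [MetricSpace X] [CompactSpace X] (S : Finset X) (f : ℝ → ℝ) (w : S → ℝ),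
      Coverage.IsGeodesic X →
      (∀ x, 0 ≤ x → 0 ≤ f x) → StrictMonoOn f (Set.Ici 0) →
      (∀ x y, 0 ≤ x → 0 ≤ y → f (x + y) ≤ f x + f y) → (∀ v, 0 ≤ w v) →
      Coverage.ApproxGuarantee (m := m) (Coverage.envCost S f) w Coverage.EnvNeighbour) :=
  (theorem2_general m hm).imp id fun h X _ _ S f w hX _ => h X S f w hX
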